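/- For a two-sided sequence $(\alpha_n)_{n\in\mathbb Z}$ in the open unit disc $\mathbb D=\{w\in\mathbb C:|w|<1\}$ put $\rho_n=(1-|\alpha_n|^2)^{1/2}$. The extended CMV matrix with Verblunsky coefficients $(\alpha_n)$ is the unitary operator $\mathcal E$ on $\ell^2(\mathbb Z)$ whose matrix has, for each $j\in\mathbb Z$, in the columns $2j-1,2j,2j+1,2j+2$ of the rows $2j$ and $2j+1$, respectively, the entries $$(\bar\alpha_{2j}\rho_{2j-1},\ -\bar\alpha_{2j}\alpha_{2j-1},\ \bar\alpha_{2j+1}\rho_{2j},\ \rho_{2j+1}\rho_{2j}),\qquad (\rho_{2j}\rho_{2j-1},\ -\rho_{2j}\alpha_{2j-1},\ -\bar\alpha_{2j+1}\alpha_{2j},\ -\rho_{2j+1}\alpha_{2j}),$$ and zeros elsewhere. **Theorem.** Let $\nu$ be a Borel probability measure on $\mathbb D$ whose topological support $\mathrm{supp}\,\nu$ is a compact subset of $\mathbb D$. Let $\Omega=(\mathrm{supp}\,\nu)^{\mathbb Z}$, $\mu=\nu^{\mathbb Z}$, and for $\omega\in\Omega$ let $\mathcal E_\omega$ be the extended CMV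 matrix with Verblunsky coefficients $\alpha_n=\omega_n$, $n\in\mathbb Z$. Then there is a closed set $\Sigma_\mu\subseteq\partial\mathbb D$, the almost sure spectrum, such that $\sigma(\mathcal E_\omega)=\Sigma_\mu$ for $\mu$-almost every $\omega\in\Omega$, and any such set satisfies $$\Sigma_\mu=\overline{\bigcup_{p\ge 1}\ \bigcup_{\alpha_1,\dots,\alpha_p\in\mathrm{supp}\,\nu}\sigma(\mathcal E_{\alpha_1,\dots,\alpha_p})},$$ where $\mathcal E_{\alpha_1,\dots,\alpha_p}$ is the extended CMV matrix whose Verblunsky coefficients are the $p$-periodic sequence on $\mathbb Z$ with values $\alpha_1,\dots,\alpha_p$ at $n=1,\dots,p$. -/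

import Mathlib

open MeasureTheory Complex
open scoped ComplexConjugate Complex.UnitDisc ENNReal

noncomputable section

namespace RandomCMV

/-! ### Extended CMV matrices -/

/-- The Hilbert space `ℓ²(ℤ)`. -/
abbrev ellTwo : Type := lp (fun _ : ℤ => ℂ) 2

/-- `ρ = (1 - |α|²)^{1/2}` for a Verblunsky coefficient `α` in the open unit disc. -/
def rho (a : 𝔻) : ℝ := Real.sqrt (1 - ‖(a : ℂ)‖ ^ 2)

/-- The `(m, n)` entry of the extended CMV matrix with Verblunsky coefficients `α : ℤ → 𝔻`.
Rows `2j` and `2j + 1` both live on the columns `2j - 1, 2j, 2j + 1, 2j + 2`, where they are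
`(ᾱ₂ⱼ ρ₂ⱼ₋₁, -ᾱ₂ⱼ α₂ⱼ₋₁, ᾱ₂ⱼ₊₁ ρ₂ⱼ, ρ₂ⱼ₊₁ ρ₂ⱼ)` and
`(ρ₂ⱼ ρ₂ⱼ₋₁, -ρ₂ⱼ α₂ⱼ₋₁, -ᾱ₂ⱼ₊₁ α₂ⱼ, -ρ₂ⱼ₊₁ α₂ⱼ)`. -/
def cmvEntry (α : ℤ → 𝔻) (m n : ℤ) : ℂ :=
  if Even m then
    if n = m - 1 then conj (α m : ℂ) * rho (α (m - 1))
    else if n = m then -(conj (α m : ℂ) * (α (m - 1) : ℂ))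
    else if n = m + 1 then conj (α (m + 1) : ℂ) * rho (α m)
    else if n = m + 2 then (rho (α (m + 1)) : ℂ) * rho (α m)
    else 0
  else
    if n = m - 2 then (rho (α (m - 1)) : ℂ) * rho (α (m - 2))
    else if n = m - 1 then -((rho (α (m - 1)) : ℂ) * (α (m - 2) : ℂ))
    else if n = m then -(conj (α m : ℂ) * (α (m - 1) : ℂ))
    else if n = m + 1 then -((rho (α m) : ℂ) * (α (m - 1) : ℂ))
    else 0

theorem norm_rho_le_one (a : 𝔻) : ‖(rho a : ℂ)‖ ≤ 1 := by
  rw [Complex.norm_real, Real.norm_of_nonneg (show 0 ≤ rho a from Real.sqrt_nonneg _)]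
  exact Real.sqrt_le_one.mpr (by nlinarith [norm_nonneg (a : ℂ)])

theorem norm_cmvEntry_le_one (α : ℤ → 𝔻) (m n : ℤ) : ‖cmvEntry α m n‖ ≤ 1 := by
  have ha : ∀ k, ‖(α k : ℂ)‖ ≤ 1 := fun k => (α k).norm_lt_one.le
  have hr : ∀ k, ‖(rho (α k) : ℂ)‖ ≤ 1 := fun k => norm_rho_le_one (α k)
  unfold cmvEntry
  split_ifs <;>
    simp only [norm_neg, norm_mul, RCLike.norm_conj, norm_zero, zero_le_one] <;>
    exact mul_le_one₀ (by first | exact ha _ | exact hr _) (norm_nonneg _)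
      (by first | exact ha _ | exact hr _)

theorem summable_sq_norm_shift (u : ellTwo) (k : ℤ) :
    Summable fun n : ℤ => ‖u (n + k)‖ ^ (2 : ℝ≥0∞).toReal :=
  ((lp.memℓp u).summable (by norm_num)).comp_injective (add_left_injective k)

theorem norm_mul_rpow_le {c x : ℂ} (hc : ‖c‖ ≤ 1) :
    ‖c * x‖ ^ (2 : ℝ≥0∞).toReal ≤ ‖x‖ ^ (2 : ℝ≥0∞).toReal := by
  refine Real.rpow_le_rpow (norm_nonneg _) ?_ (by norm_num)
  rw [norm_mul]
  exact mul_le_of_le_one_left (norm_nonneg _) hc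

/-- The bounded operator on `ℓ²(ℤ)` whose matrix has the single diagonal `n ↦ (n, n + k)`, with the
(bounded) entries `c n` on it: `(diagOp c u)(n) = c n * u (n + k)`. -/
def diagOp (c : ℤ → ℂ) (hc : ∀ n, ‖c n‖ ≤ 1) (k : ℤ) : ellTwo →L[ℂ] ellTwo :=
  LinearMap.mkContinuous
    { toFun := fun u => ⟨fun n => c n * u (n + k), memℓp_gen <|
        (summable_sq_norm_shift u k).of_nonneg_of_le (fun _ => by positivity)
          (fun n => norm_mul_rpow_le (hc n))⟩
      map_add' := fun u v => by
        ext n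
        exact mul_add (c n) (u (n + k)) (v (n + k))
      map_smul' := fun a u => by
        ext n
        exact mul_left_comm (c n) a (u (n + k)) }
    1 (fun u => by
      rw [one_mul]
      refine lp.norm_le_of_tsum_le (by norm_num) (norm_nonneg _) ?_
      rw [lp.norm_rpow_eq_tsum (by norm_num) u]
      have hu := (lp.memℓp u).summable (show 0 < (2 : ℝ≥0∞).toReal by norm_num)
      refine ((summable_sq_norm_shift u k).of_nonneg_of_le (fun _ => by positivity)
          (fun n => norm_mul_rpow_le (hc n))).tsum_le_tsum
            (fun n => norm_mul_rpow_le (hc n)) (summable_sq_norm_shift u k) |>.trans ?_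
      exact ((Equiv.addRight k).tsum_eq (fun n => ‖u n‖ ^ (2 : ℝ≥0∞).toReal)).le)

/-- The extended CMV matrix with Verblunsky coefficients `α`, as a bounded operator on `ℓ²(ℤ)`:
the sum of its five diagonals. -/
def extendedCMV (α : ℤ → 𝔻) : ellTwo →L[ℂ] ellTwo :=
  ∑ k ∈ Finset.Icc (-2 : ℤ) 2,
    diagOp (fun n => cmvEntry α n (n + k)) (fun n => norm_cmvEntry_le_one α n (n + k)) k

theorem extendedCMV_apply (α : ℤ → 𝔻) (u : ellTwo) (n : ℤ) :
    extendedCMV α u n = ∑ k ∈ Finset.Icc (-2 : ℤ) 2, cmvEntry α n (n + k) * u (n + k) := by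
  unfold extendedCMV
  rw [_root_.sum_apply, lp.coeFn_sum, Finset.sum_apply]
  rfl

/-- The operator `extendedCMV α` has the matrix `cmvEntry α` in the standard basis. -/
theorem extendedCMV_single (α : ℤ → 𝔻) (m n : ℤ) :
    extendedCMV α (lp.single 2 n (1 : ℂ)) m = cmvEntry α m n := by
  rw [extendedCMV_apply]
  simp only [lp.single_apply, Pi.single_apply, mul_ite, mul_one, mul_zero]
  by_cases h : n - m ∈ Finset.Icc (-2 : ℤ) 2
  · rw [Finset.sum_eq_single_of_mem (n - m) h
      (fun k _ hk => if_neg fun h' => hk (by omega)), if_pos (by omega)]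
    congr 1
    omega
  · rw [Finset.sum_eq_zero fun k hk => if_neg fun h' => h (by
      rwa [show n - m = k by omega])]
    rw [Finset.mem_Icc] at h
    unfold cmvEntry
    split_ifs <;> first | rfl | omega

/-- The `p`-periodic sequence `(αₙ)` on `ℤ` with `α₁ = a 0, …, α_p = a (p - 1)`. -/
def periodicSeq {X : Type*} {p : ℕ} (hp : 0 < p) (a : Fin p → X) (n : ℤ) : X :=
  a ⟨((n - 1) % (p : ℤ)).toNat, by
    have h₁ := Int.emod_nonneg (n - 1) (show (p : ℤ) ≠ 0 by omega)
    have h₂ := Int.emod_lt_of_pos (n - 1) (show (0 : ℤ) < p by omega)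
    omega⟩

/-! ### The random model -/

/-- The open unit disc carries its Borel `σ`-algebra. -/
instance instMeasurableSpaceUnitDisc : MeasurableSpace 𝔻 := borel 𝔻

instance instBorelSpaceUnitDisc : BorelSpace 𝔻 := ⟨rfl⟩

instance instSecondCountableUnitDisc : SecondCountableTopology 𝔻 :=
  UnitDisc.isEmbedding_coe.secondCountableTopology

/-- The sample space `Ω = (supp ν)^ℤ`. -/
abbrev Omega (ν : Measure 𝔻) : Type := ℤ → ν.support

/-- The measure `ν`, regarded as a measure on its own topological support. -/
def onSupport (ν : Measure 𝔻) : Measure ν.support := ν.comap Subtype.val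

/-- `onSupport ν` is a probability measure if `ν` is. -/
instance instIsProbabilityMeasureOnSupport (ν : Measure 𝔻) [IsProbabilityMeasure ν] :
    IsProbabilityMeasure (onSupport ν) :=
  (MeasurableEmbedding.subtype_coe
    (Measure.isClosed_support (μ := ν)).measurableSet).isProbabilityMeasure_comap <| by
      rw [Subtype.range_coe]
      exact Measure.support_mem_ae

/-- The product measure `μ = ν^ℤ` on `Ω = (supp ν)^ℤ`. -/
def productMeasure (ν : Measure 𝔻) : Measure (Omega ν) :=
  Measure.infinitePi fun _ : ℤ => onSupport ν

/-- The random extended CMV matrix `𝓔_ω`, with Verblunsky coefficients `(ω n)`, `n ∈ ℤ`. -/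
def randomCMV {ν : Measure 𝔻} (ω : Omega ν) : ellTwo →L[ℂ] ellTwo :=
  extendedCMV fun n => (ω n : 𝔻)

/-- `S` is the almost sure spectrum `Σ_μ` of the family `(𝓔_ω)`: a closed subset of the unit circle
with `σ(𝓔_ω) = S` for `μ`-almost every `ω`. -/
def IsAlmostSureSpectrum (ν : Measure 𝔻) (S : Set ℂ) : Prop :=
  IsClosed S ∧ S ⊆ Metric.sphere (0 : ℂ) 1 ∧
    ∀ᵐ ω ∂(productMeasure ν), spectrum ℂ (randomCMV ω) = S

/-- The union, over all periods `p ≥ 1` and all `α₁, …, α_p ∈ supp ν`, of the spectra of the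
periodic extended CMV matrices `𝓔_{α₁, …, α_p}`. -/
def periodicSpectra (ν : Measure 𝔻) : Set ℂ :=
  ⋃ (p : ℕ) (hp : 0 < p) (a : Fin p → ν.support),
    spectrum ℂ (extendedCMV (periodicSeq hp fun i => (a i : 𝔻)))

end RandomCMV

end

/-!
For a normal operator `A`, the distance from `z` to `σ(A)` is the infimum of `‖(z - A) v‖` over unit
vectors `v`. Hence an approximate eigenvector of `A` at `z` forces spectrum near `z` for every
normal operator that is close to `A` on that single vector, so the spectrum is lower hemicontinuous
along a strongly continuous family of normal operators. The extended CMV matrices form such a family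
in the product topology on the Verblunsky coefficients. Periodic sequences are dense in that
topology, so *every* `σ(𝓔_ω)` lies in the closure of the periodic spectra. Conversely, almost every
`ω` has a dense orbit under the even shifts, which act on `𝓔_ω` by unitary conjugation; so `σ(𝓔_ω)`
contains every periodic spectrum. (Odd shifts would not do: the even and odd rows of an extended CMV
matrix have different shapes.)
-/

namespace RandomCMV

open Filter Topology TopologicalSpace

section LowerHemicontinuity

theorem subset_closure_biUnion_of_lowerHemicontinuous {X Y : Type*} [TopologicalSpace X]
    [TopologicalSpace Y] {F : X → Set Y} (hF : LowerHemicontinuous F) {D : Set X} (hD : Dense D)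
    (x : X) : F x ⊆ closure (⋃ y ∈ D, F y) := by
  intro z hz
  rw [mem_closure_iff]
  intro U hU hzU
  obtain ⟨y, ⟨w, hw, hwU⟩, hy⟩ := hD.inter_open_nonempty _
    (lowerHemicontinuous_iff_isOpen_inter_nonempty.1 hF U hU) ⟨x, z, hz, hzU⟩
  exact ⟨w, hwU, Set.mem_biUnion hy hw⟩

end LowerHemicontinuity

section NormalOperator

theorem isStarNormal_algebraMap_sub {R 𝒜 : Type*} [CommRing R] [StarRing R] [Ring 𝒜] [StarRing 𝒜]
    [Algebra R 𝒜] [StarModule R 𝒜] (a : 𝒜) [IsStarNormal a] (r : R) :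
    IsStarNormal (algebraMap R 𝒜 r - a) := by
  refine ⟨?_⟩
  rw [star_sub, ← algebraMap_star_comm]
  exact (Algebra.commute_algebraMap_left _ _).sub_left
    ((Algebra.commute_algebraMap_right _ _).sub_right star_comm_self)

theorem algebraMap_sq_infDist_spectrum_le {𝒜 : Type*} [CStarAlgebra 𝒜] [PartialOrder 𝒜]
    [StarOrderedRing 𝒜] (a : 𝒜) [IsStarNormal a] (z : ℂ) :
    algebraMap ℝ 𝒜 (Metric.infDist z (spectrum ℂ a) ^ 2) ≤
      star (algebraMap ℂ 𝒜 z - a) * (algebraMap ℂ 𝒜 z - a) := by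
  open scoped ComplexOrder in
  have hcfc : algebraMap ℂ 𝒜 z - a = cfc (fun x => z - x) a := by
    rw [cfc_sub (fun _ => z) (fun x => x) a, cfc_const z a, cfc_id' ℂ a]
  rw [hcfc, ← cfc_star, ← cfc_mul _ _ a, IsScalarTower.algebraMap_apply ℝ ℂ 𝒜]
  refine algebraMap_le_cfc _ _ a fun x hx => ?_
  have hdist : Metric.infDist z (spectrum ℂ a) ≤ ‖z - x‖ :=
    (Metric.infDist_le_dist_of_mem hx).trans_eq (dist_eq_norm z x)
  rw [RCLike.star_def, Complex.conj_mul', Complex.coe_algebraMap]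
  exact_mod_cast pow_le_pow_left₀ Metric.infDist_nonneg hdist 2

theorem isUnit_of_isStarNormal_of_mul_norm_le {𝕜 H : Type*} [RCLike 𝕜] [NormedAddCommGroup H]
    [InnerProductSpace 𝕜 H] [CompleteSpace H] (B : H →L[𝕜] H) [IsStarNormal B] {c : ℝ}
    (hc : 0 < c) (hB : ∀ v, c * ‖v‖ ≤ ‖B v‖) : IsUnit B := by
  lift c to NNReal using hc.le
  have hanti : AntilipschitzWith c⁻¹ B := B.antilipschitz_of_bound fun v => by
    rw [NNReal.coe_inv, inv_mul_eq_div, le_div_iff₀' hc]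
    exact hB v
  rw [ContinuousLinearMap.isUnit_iff_bijective,
    ContinuousLinearMap.bijective_iff_dense_range_and_antilipschitz]
  refine ⟨?_, _, hanti⟩
  rw [Submodule.topologicalClosure_eq_top_iff,
    ContinuousLinearMap.IsStarNormal.orthogonal_range ‹_›]
  exact LinearMap.ker_eq_bot.2 hanti.injective

theorem exists_norm_lt_of_mem_spectrum {𝕜 H : Type*} [RCLike 𝕜] [NormedAddCommGroup H]
    [InnerProductSpace 𝕜 H] [CompleteSpace H] (A : H →L[𝕜] H) [IsStarNormal A] {z : 𝕜}
    (hz : z ∈ spectrum 𝕜 A) {ε : ℝ} (hε : 0 < ε) :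
    ∃ v : H, ‖(algebraMap 𝕜 (H →L[𝕜] H) z - A) v‖ < ε * ‖v‖ := by
  by_contra! hbelow
  have := isStarNormal_algebraMap_sub A z
  exact hz (isUnit_of_isStarNormal_of_mul_norm_le _ hε hbelow)

variable {H : Type*} [NormedAddCommGroup H] [InnerProductSpace ℂ H] [CompleteSpace H]

theorem infDist_spectrum_mul_norm_le (A : H →L[ℂ] H) [IsStarNormal A] (z : ℂ) (v : H) :
    Metric.infDist z (spectrum ℂ A) * ‖v‖ ≤ ‖(algebraMap ℂ (H →L[ℂ] H) z - A) v‖ := by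
  have hpos := ((ContinuousLinearMap.le_def _ _).1
    (algebraMap_sq_infDist_spectrum_le A z)).re_inner_nonneg_left v
  rw [sub_apply, inner_sub_left, map_sub, sub_nonneg, ContinuousLinearMap.algebraMap_apply,
    inner_smul_left_eq_smul, RCLike.smul_re, inner_self_eq_norm_sq,
    ContinuousLinearMap.star_eq_adjoint, mul_apply_eq_comp,
    ContinuousLinearMap.adjoint_inner_left, inner_self_eq_norm_sq, ← mul_pow] at hpos
  exact le_of_sq_le_sq hpos (norm_nonneg _)

theorem lowerHemicontinuous_spectrum {X : Type*} [TopologicalSpace X] {A : X → H →L[ℂ] H}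
    [∀ x, IsStarNormal (A x)] (hA : ∀ v, Continuous fun x => A x v) :
    LowerHemicontinuous fun x => spectrum ℂ (A x) := by
  refine fun x => lowerHemicontinuousAt_iff.2 fun U hU ⟨z, hz, hzU⟩ => ?_
  obtain ⟨ε, hε, hεU⟩ := Metric.isOpen_iff.1 hU z hzU
  obtain ⟨v, hv⟩ := exists_norm_lt_of_mem_spectrum (A x) hz hε
  have hcont : Continuous fun y => ‖(algebraMap ℂ (H →L[ℂ] H) z - A y) v‖ :=
    (continuous_const.sub (hA v)).norm
  filter_upwards [hcont.continuousAt.eventually_lt_const hv] with y hy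
  have hvpos : 0 < ‖v‖ := by
    by_contra! hle
    simp [norm_le_zero_iff.1 hle] at hy
  have : Nontrivial H := ⟨v, 0, norm_pos_iff.1 hvpos⟩
  obtain ⟨w, hw, hzw⟩ := (Metric.infDist_lt_iff (spectrum.nonempty (A y))).1
    (lt_of_mul_lt_mul_right ((infDist_spectrum_mul_norm_le (A y) z v).trans_lt hy) hvpos.le)
  exact ⟨w, hw, hεU (Metric.mem_ball'.2 hzw)⟩

end NormalOperator

section Unitary

theorem diagOp_apply (c : ℤ → ℂ) (hc : ∀ n, ‖c n‖ ≤ 1) (k : ℤ) (u : ellTwo) (n : ℤ) :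
    diagOp c hc k u n = c n * u (n + k) :=
  rfl

theorem star_diagOp (c : ℤ → ℂ) (hc : ∀ n, ‖c n‖ ≤ 1) (k : ℤ) :
    star (diagOp c hc k) =
      diagOp (fun n => conj (c (n - k))) (fun n => by simpa using hc (n - k)) (-k) := by
  rw [ContinuousLinearMap.star_eq_adjoint, eq_comm, ContinuousLinearMap.eq_adjoint_iff]
  intro u v
  rw [lp.inner_eq_tsum, lp.inner_eq_tsum, ← (Equiv.addRight k).tsum_eq]
  refine tsum_congr fun n => ?_
  simp only [Equiv.coe_addRight, diagOp_apply, RCLike.inner_apply, map_mul, add_sub_cancel_right,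
    Complex.conj_conj, add_neg_cancel_right]
  ring

/-- The `(m, n)` entry of the direct sum of the `2 × 2` blocks `(ᾱⱼ, ρⱼ; ρⱼ, -αⱼ)`, the block of
index `j` sitting at the coordinates `j, j + 1` and `j` running over the integers with the parity
of `b`. For `b = 0` and `b = 1` these are the factors of the `LM` factorization of the extended CMV
matrix. -/
noncomputable def blockEntry (b : ℤ) (α : ℤ → 𝔻) (m n : ℤ) : ℂ :=
  if Even (m + b) then
    if n = m then conj (α m : ℂ) else if n = m + 1 then rho (α m) else 0
  else
    if n = m - 1 then rho (α (m - 1)) else if n = m then -(α (m - 1) : ℂ) else 0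

theorem norm_blockEntry_le_one (b : ℤ) (α : ℤ → 𝔻) (m n : ℤ) : ‖blockEntry b α m n‖ ≤ 1 := by
  unfold blockEntry
  split_ifs <;>
    simp only [norm_neg, RCLike.norm_conj, norm_zero, zero_le_one, norm_rho_le_one,
      (α _).norm_lt_one.le]

/-- The direct sum of `2 × 2` blocks with matrix `blockEntry b α`, as a bounded operator: the sum of
its three diagonals. -/
noncomputable def blockOp (b : ℤ) (α : ℤ → 𝔻) : ellTwo →L[ℂ] ellTwo :=
  ∑ k ∈ Finset.Icc (-1 : ℤ) 1,
    diagOp (fun n => blockEntry b α n (n + k)) (fun n => norm_blockEntry_le_one b α n (n + k)) k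

theorem blockOp_apply (b : ℤ) (α : ℤ → 𝔻) (u : ellTwo) (n : ℤ) :
    blockOp b α u n = if Even (n + b) then conj (α n : ℂ) * u n + rho (α n) * u (n + 1)
      else rho (α (n - 1)) * u (n - 1) - α (n - 1) * u n := by
  have hI : Finset.Icc (-1 : ℤ) 1 = {-1, 0, 1} := by decide
  unfold blockOp
  rw [_root_.sum_apply, lp.coeFn_sum, Finset.sum_apply]
  simp only [diagOp_apply, hI, blockEntry]
  split_ifs <;> simp [sub_eq_add_neg]

theorem rho_star (a : 𝔻) : rho (star a) = rho a := by
  simp [rho]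

theorem rho_mul_rho (a : 𝔻) : (rho a : ℂ) * rho a = 1 - conj (a : ℂ) * a := by
  have hnonneg : 0 ≤ 1 - ‖(a : ℂ)‖ ^ 2 := by nlinarith [norm_nonneg (a : ℂ), a.norm_lt_one]
  rw [← Complex.ofReal_mul, rho, Real.mul_self_sqrt hnonneg, Complex.conj_mul']
  push_cast
  rfl

theorem blockEntry_star (b : ℤ) (α : ℤ → 𝔻) (m n : ℤ) :
    blockEntry b (fun j => star (α j)) m n = conj (blockEntry b α n m) := by
  have hparity : Even (m + b) → Even (n + b) → n ≠ m - 1 ∧ n ≠ m + 1 := by grind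
  simp only [blockEntry, apply_ite conj, map_neg, map_zero, Complex.conj_conj, Complex.conj_ofReal,
    UnitDisc.coe_star, rho_star]
  split_ifs <;> grind

theorem star_blockOp (b : ℤ) (α : ℤ → 𝔻) :
    star (blockOp b α) = blockOp b fun n => star (α n) := by
  unfold blockOp
  simp only [star_sum, star_diagOp]
  have hneg (k : ℤ) (hk : k ∈ Finset.Icc (-1) 1) : -k ∈ Finset.Icc (-1 : ℤ) 1 := by
    rw [Finset.mem_Icc] at hk ⊢
    omega
  refine Finset.sum_nbij' (- ·) (- ·) hneg hneg (by simp) (by simp) fun k _ => ?_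
  simp only [blockEntry_star, sub_add_cancel, ← sub_eq_add_neg]

theorem blockOp_star_mul (b : ℤ) (α : ℤ → 𝔻) :
    (blockOp b fun n => star (α n)) * blockOp b α = 1 := by
  ext u n
  have hpred : Even (n - 1 + b) ↔ ¬ Even (n + b) := by grind
  have hsucc : Even (n + 1 + b) ↔ ¬ Even (n + b) := by grind
  simp only [mul_apply_eq_comp, one_apply_eq_self, blockOp_apply, hpred, hsucc, rho_star,
    UnitDisc.coe_star, Complex.conj_conj, add_sub_cancel_right, sub_add_cancel]
  split_ifs with h
  · linear_combination u n * rho_mul_rho (α n)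
  · linear_combination u n * rho_mul_rho (α (n - 1))

theorem blockOp_mem_unitary (b : ℤ) (α : ℤ → 𝔻) :
    blockOp b α ∈ unitary (ellTwo →L[ℂ] ellTwo) := by
  rw [Unitary.mem_iff, star_blockOp]
  exact ⟨blockOp_star_mul b α, by
    simpa only [star_star] using blockOp_star_mul b fun n => star (α n)⟩

theorem extendedCMV_eq_mul (α : ℤ → 𝔻) : extendedCMV α = blockOp 0 α * blockOp 1 α := by
  ext u n
  have hI : Finset.Icc (-2 : ℤ) 2 = {-2, -1, 0, 1, 2} := by decide
  have hsum (f : ℤ → ℂ) : ∑ k ∈ Finset.Icc (-2) 2, f k = f (-2) + f (-1) + f 0 + f 1 + f 2 := by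
    simp [hI, add_assoc]
  rw [mul_apply_eq_comp, extendedCMV_apply, hsum]
  have hparity : Even (n + 1) ↔ ¬ Even n := Int.even_add_one
  simp only [blockOp_apply, cmvEntry]
  grind

theorem extendedCMV_mem_unitary (α : ℤ → 𝔻) :
    extendedCMV α ∈ unitary (ellTwo →L[ℂ] ellTwo) :=
  extendedCMV_eq_mul α ▸ mul_mem (blockOp_mem_unitary 0 α) (blockOp_mem_unitary 1 α)

instance isStarNormal_extendedCMV (α : ℤ → 𝔻) : IsStarNormal (extendedCMV α) :=
  isStarNormal_of_mem_unitary (extendedCMV_mem_unitary α)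

end Unitary

section Shift

/-- Translation by `k` on `ℓ²(ℤ)`, as a unit of the algebra of bounded operators. -/
noncomputable def translation (k : ℤ) : (ellTwo →L[ℂ] ellTwo)ˣ where
  val := diagOp (fun _ => 1) (by simp) k
  inv := diagOp (fun _ => 1) (by simp) (-k)
  val_inv := by
    ext u n
    simp [diagOp_apply]
  inv_val := by
    ext u n
    simp [diagOp_apply]

theorem translation_apply (k : ℤ) (u : ellTwo) (n : ℤ) :
    (translation k : ellTwo →L[ℂ] ellTwo) u n = u (n + k) :=
  one_mul _

theorem translation_inv_apply (k : ℤ) (u : ellTwo) (n : ℤ) :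
    (↑(translation k)⁻¹ : ellTwo →L[ℂ] ellTwo) u n = u (n - k) :=
  one_mul _

theorem cmvEntry_even_shift (α : ℤ → 𝔻) (k m n : ℤ) :
    cmvEntry (fun i => α (i + 2 * k)) m n = cmvEntry α (m + 2 * k) (n + 2 * k) := by
  have heven : Even (m + 2 * k) ↔ Even m := by grind
  have hsub (j : ℤ) : n + 2 * k = m + 2 * k - j ↔ n = m - j := by omega
  simp only [cmvEntry, heven, hsub, add_left_inj, sub_add_eq_add_sub, add_right_comm m]

theorem extendedCMV_even_shift (α : ℤ → 𝔻) (k : ℤ) :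
    extendedCMV (fun i => α (i + 2 * k)) =
      translation (2 * k) * extendedCMV α * ↑(translation (2 * k))⁻¹ := by
  ext u n
  simp only [mul_apply_eq_comp, translation_apply, extendedCMV_apply, translation_inv_apply,
    cmvEntry_even_shift, add_right_comm n (2 * k), add_sub_cancel_right]

theorem spectrum_extendedCMV_even_shift (α : ℤ → 𝔻) (k : ℤ) :
    spectrum ℂ (extendedCMV fun i => α (i + 2 * k)) = spectrum ℂ (extendedCMV α) := by
  rw [extendedCMV_even_shift, spectrum.units_conjugate]

end Shift

section Continuity

theorem continuous_rho : Continuous rho := by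
  unfold rho
  fun_prop

theorem continuous_cmvEntry (m n : ℤ) : Continuous fun α : ℤ → 𝔻 => cmvEntry α m n := by
  have hρ (k : ℤ) : Continuous fun α : ℤ → 𝔻 => (rho (α k) : ℂ) :=
    Complex.continuous_ofReal.comp (continuous_rho.comp (continuous_apply k))
  unfold cmvEntry
  split_ifs <;> fun_prop

theorem norm_sq_eq_tsum (u : ellTwo) : ‖u‖ ^ 2 = ∑' n, ‖u n‖ ^ 2 := by
  simpa using lp.norm_rpow_eq_tsum (p := 2) (by norm_num) u

theorem continuous_diagOp_apply {X : Type*} [TopologicalSpace X] {c : X → ℤ → ℂ}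
    (hc : ∀ x n, ‖c x n‖ ≤ 1) (hcont : ∀ n, Continuous fun x => c x n) (k : ℤ) (u : ellTwo) :
    Continuous fun x => diagOp (c x) (hc x) k u := by
  refine continuous_iff_continuousAt.2 fun x => ?_
  have hsq (y : X) : ‖diagOp (c y) (hc y) k u - diagOp (c x) (hc x) k u‖ ^ 2 =
      ∑' n, ‖(c y n - c x n) * u (n + k)‖ ^ 2 := by
    rw [norm_sq_eq_tsum]
    simp only [lp.coeFn_sub, Pi.sub_apply, diagOp_apply, sub_mul]
  have hsummable : Summable fun n : ℤ => 2 ^ 2 * ‖u (n + k)‖ ^ 2 := by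
    simpa using (summable_sq_norm_shift u k).mul_left (2 ^ 2)
  have hbound (y : X) (n : ℤ) :
      ‖‖(c y n - c x n) * u (n + k)‖ ^ 2‖ ≤ 2 ^ 2 * ‖u (n + k)‖ ^ 2 := by
    have h2 : ‖c y n - c x n‖ ≤ 2 := (norm_sub_le _ _).trans (by linarith [hc y n, hc x n])
    rw [norm_pow, norm_norm, norm_mul, mul_pow]
    gcongr
  have hpointwise (n : ℤ) : Tendsto (fun y => ‖(c y n - c x n) * u (n + k)‖ ^ 2) (𝓝 x) (𝓝 0) := by
    have := hcont n
    exact Continuous.tendsto' (by fun_prop) x 0 (by simp)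
  have hlim := tendsto_tsum_of_dominated_convergence hsummable hpointwise
    (Eventually.of_forall hbound)
  simp only [← hsq, tsum_zero] at hlim
  rw [ContinuousAt, tendsto_iff_norm_sub_tendsto_zero]
  simpa using hlim.sqrt

theorem continuous_extendedCMV_apply (u : ellTwo) :
    Continuous fun α : ℤ → 𝔻 => extendedCMV α u := by
  simp only [extendedCMV, _root_.sum_apply]
  exact continuous_finsetSum _ fun k _ =>
    continuous_diagOp_apply (fun α n => norm_cmvEntry_le_one α n (n + k))
      (fun n => continuous_cmvEntry n (n + k)) k u

theorem lowerHemicontinuous_spectrum_extendedCMV :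
    LowerHemicontinuous fun α : ℤ → 𝔻 => spectrum ℂ (extendedCMV α) :=
  lowerHemicontinuous_spectrum continuous_extendedCMV_apply

end Continuity

section PeriodicSequences

variable {X : Type*}

theorem periodicSeq_of_periodic {p : ℕ} (hp : 0 < p) {s : ℤ → X}
    (hs : Function.Periodic s (p : ℤ)) : periodicSeq hp (fun i => s (i + 1)) = s := by
  funext n
  have hmod : 0 ≤ (n - 1) % (p : ℤ) := Int.emod_nonneg _ (by omega)
  simp only [periodicSeq, Int.toNat_of_nonneg hmod]
  rw [← hs.int_mul ((n - 1) / p) ((n - 1) % p + 1)]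
  congr 1
  linear_combination Int.mul_ediv_add_emod (n - 1) p

theorem tendsto_bmod_atTop [TopologicalSpace X] (α : ℤ → X) :
    Tendsto (fun (N : ℕ) (n : ℤ) => α (n.bmod (2 * N + 1))) atTop (𝓝 α) := by
  refine tendsto_pi_nhds.2 fun n => tendsto_const_nhds.congr' ?_
  filter_upwards [eventually_ge_atTop n.natAbs] with N hN
  rw [Int.bmod_eq_of_le_mul_two (by push_cast; omega) (by push_cast; omega)]

theorem dense_iUnion_range_periodicSeq [TopologicalSpace X] :
    Dense (⋃ (p : ℕ) (hp : 0 < p), Set.range (periodicSeq (X := X) hp)) := fun α => by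
  refine mem_closure_of_tendsto (tendsto_bmod_atTop α) (Eventually.of_forall fun N => ?_)
  have hperiodic : Function.Periodic (fun n : ℤ => α (n.bmod (2 * N + 1)))
      ((2 * N + 1 : ℕ) : ℤ) := fun n => congrArg α (Int.add_bmod_right n (2 * N + 1))
  exact Set.mem_iUnion₂.2 ⟨2 * N + 1, by omega, _, periodicSeq_of_periodic _ hperiodic⟩

end PeriodicSequences

section DenseOrbit

theorem exists_injective_add_mul (I : Finset ℤ) {d : ℤ} (hd : d ≠ 0) :
    ∃ N : ℤ, Function.Injective fun x : ℕ × I => (x.2 : ℤ) + d * (N * x.1) := by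
  obtain ⟨R, hR⟩ : ∃ R : ℕ, ∀ i ∈ I, i.natAbs ≤ R :=
    ⟨I.sup Int.natAbs, fun i hi => Finset.le_sup (f := Int.natAbs) hi⟩
  refine ⟨2 * R + 1, ?_⟩
  rintro ⟨k, i, hi⟩ ⟨l, j, hj⟩ h
  simp only at h
  have hdvd : (2 * R + 1 : ℤ) ∣ i - j := ⟨d * (l - k), by linear_combination h⟩
  have hij : i = j := by
    have hlt : |i - j| < 2 * R + 1 := by
      have := hR i hi
      have := hR j hj
      rw [abs_lt]
      omega
    exact sub_eq_zero.1 (Int.eq_zero_of_abs_lt_dvd hdvd hlt)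
  subst hij
  have hkl : (2 * R + 1 : ℤ) * k = (2 * R + 1) * l := mul_left_cancel₀ hd (add_left_cancel h)
  have : (k : ℤ) = l := mul_left_cancel₀ (by omega) hkl
  simpa using this

theorem ae_exists_apply_mem {Y : Type*} [MeasurableSpace Y] (P : Measure Y)
    [IsProbabilityMeasure P] {B : Set Y} (hB : MeasurableSet B) (hPB : P B ≠ 0) :
    ∀ᵐ x ∂(Measure.infinitePi fun _ : ℕ => P), ∃ k, x k ∈ B := by
  have hlt : P Bᶜ < 1 := by
    rw [prob_compl_eq_one_sub hB]
    exact ENNReal.sub_lt_self ENNReal.one_ne_top one_ne_zero hPB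
  have hle (n : ℕ) : (Measure.infinitePi fun _ : ℕ => P) {x | ¬ ∃ k, x k ∈ B} ≤ P Bᶜ ^ n := calc
    _ ≤ (Measure.infinitePi fun _ : ℕ => P) (Set.pi (Finset.range n) fun _ => Bᶜ) :=
      measure_mono fun x (hx : ¬ ∃ k, x k ∈ B) k _ hk => hx ⟨k, hk⟩
    _ = P Bᶜ ^ n := by
      rw [Measure.infinitePi_pi _ fun _ _ => hB.compl, Finset.prod_const, Finset.card_range]
  exact le_zero_iff.1 (ge_of_tendsto' (ENNReal.tendsto_pow_atTop_nhds_zero_of_lt_one hlt) hle)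

theorem measurePreserving_infinitePi_curry_comp {ι κ I X : Type*} [MeasurableSpace X]
    (m : Measure X) [IsProbabilityMeasure m] {f : κ × I → ι} (hf : Function.Injective f) :
    MeasurePreserving (fun (ω : ι → X) k i => ω (f (k, i))) (Measure.infinitePi fun _ => m)
      (Measure.infinitePi fun _ => Measure.infinitePi fun _ => m) where
  measurable := by fun_prop
  map_eq := by
    rw [← Measure.infinitePi_map_curry (fun _ _ => m),
      ← Measure.map_infinitePi_infinitePi_of_inj (P := fun _ => m) hf,
      Measure.map_map (by fun_prop) (by fun_prop)]
    rfl

variable {X : Type*} [TopologicalSpace X] [MeasurableSpace X] [OpensMeasurableSpace X]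
  (m : Measure X) [IsProbabilityMeasure m] [m.IsOpenPosMeasure] {d : ℤ}

theorem ae_exists_shift_mem (hd : d ≠ 0) {U : Set (ℤ → X)} (hU : IsOpen U) (hne : U.Nonempty) :
    ∀ᵐ ω ∂(Measure.infinitePi fun _ : ℤ => m), ∃ k : ℤ, (fun n => ω (n + d * k)) ∈ U := by
  obtain ⟨α, hα⟩ := hne
  obtain ⟨I, u, hu, hIU⟩ := isOpen_pi_iff.1 hU α hα
  obtain ⟨N, hN⟩ := exists_injective_add_mul I hd
  let B : Set (I → X) := Set.univ.pi fun i => u i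
  have hBmeas : MeasurableSet B := .univ_pi fun i => (hu i i.2).1.measurableSet
  have hBpos : (Measure.infinitePi fun _ : I => m) B ≠ 0 := by
    rw [Measure.infinitePi_eq_pi, Measure.pi_pi]
    exact Finset.prod_ne_zero_iff.2 fun i _ =>
      (hu i i.2).1.measure_ne_zero m ⟨α i, (hu i i.2).2⟩
  filter_upwards [(measurePreserving_infinitePi_curry_comp m hN).quasiMeasurePreserving.ae
    (ae_exists_apply_mem _ hBmeas hBpos)] with ω ⟨k, hk⟩
  exact ⟨N * k, hIU fun i hi => hk ⟨i, hi⟩ trivial⟩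

theorem ae_denseRange_shift [SecondCountableTopology X] (hd : d ≠ 0) :
    ∀ᵐ ω ∂(Measure.infinitePi fun _ : ℤ => m), DenseRange fun (k : ℤ) n => ω (n + d * k) := by
  have hbasis : ∀ᵐ ω ∂(Measure.infinitePi fun _ : ℤ => m), ∀ U ∈ countableBasis (ℤ → X),
      ∃ k : ℤ, (fun n => ω (n + d * k)) ∈ U :=
    (ae_ball_iff (countable_countableBasis _)).2 fun U hU =>
      ae_exists_shift_mem m hd (isOpen_of_mem_countableBasis hU)
        (nonempty_of_mem_countableBasis hU)
  filter_upwards [hbasis] with ω hω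
  refine (isBasis_countableBasis _).dense_iff.2 fun U hU _ => ?_
  obtain ⟨k, hk⟩ := hω U hU
  exact ⟨_, hk, k, rfl⟩

end DenseOrbit

section AlmostSureSpectrum

variable (ν : Measure 𝔻)

instance isOpenPosMeasure_onSupport : (onSupport ν).IsOpenPosMeasure := by
  refine ⟨fun U hU ⟨x, hx⟩ => ?_⟩
  obtain ⟨V, hV, rfl⟩ := isOpen_induced_iff.1 hU
  rw [onSupport, (MeasurableEmbedding.subtype_coe
    (Measure.isClosed_support (μ := ν)).measurableSet).comap_apply,
    Subtype.image_preimage_coe, Set.inter_comm, measure_inter_conull Measure.support_mem_ae]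
  exact ((Measure.mem_support_iff_forall _).1 x.2 V (hV.mem_nhds hx)).ne'

instance isProbabilityMeasure_productMeasure [IsProbabilityMeasure ν] :
    IsProbabilityMeasure (productMeasure ν) := by
  unfold productMeasure
  infer_instance

variable {ν}

theorem lowerHemicontinuous_spectrum_randomCMV :
    LowerHemicontinuous fun ω : Omega ν => spectrum ℂ (randomCMV ω) :=
  lowerHemicontinuous_spectrum_extendedCMV.comp (g := fun (ω : Omega ν) n => (ω n : 𝔻))
    (by fun_prop)

theorem spectrum_randomCMV_subset_closure (ω : Omega ν) :
    spectrum ℂ (randomCMV ω) ⊆ closure (periodicSpectra ν) := by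
  refine (subset_closure_biUnion_of_lowerHemicontinuous lowerHemicontinuous_spectrum_randomCMV
    dense_iUnion_range_periodicSeq ω).trans (closure_mono ?_)
  simp only [Set.iUnion_subset_iff, Set.mem_iUnion, Set.mem_range]
  rintro _ ⟨p, hp, a, rfl⟩
  exact Set.subset_iUnion₂_of_subset p hp (Set.subset_iUnion_of_subset a subset_rfl)

theorem periodicSpectra_subset_spectrum_randomCMV {ω : Omega ν}
    (hω : DenseRange fun (k : ℤ) n => ω (n + 2 * k)) :
    periodicSpectra ν ⊆ spectrum ℂ (randomCMV ω) := by
  refine Set.iUnion₂_subset fun p hp => Set.iUnion_subset fun a => ?_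
  refine (subset_closure_biUnion_of_lowerHemicontinuous lowerHemicontinuous_spectrum_randomCMV
    hω (periodicSeq hp a)).trans (closure_minimal ?_ (spectrum.isClosed _))
  rw [Set.biUnion_range]
  exact Set.iUnion_subset fun k =>
    (spectrum_extendedCMV_even_shift (fun n => (ω n : 𝔻)) k).subset

variable (ν)

theorem ae_spectrum_randomCMV_eq [IsProbabilityMeasure ν] :
    ∀ᵐ ω ∂(productMeasure ν), spectrum ℂ (randomCMV ω) = closure (periodicSpectra ν) := by
  filter_upwards [ae_denseRange_shift (onSupport ν) two_ne_zero] with ω hω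
  exact (spectrum_randomCMV_subset_closure ω).antisymm
    (closure_minimal (periodicSpectra_subset_spectrum_randomCMV hω) (spectrum.isClosed _))

theorem periodicSpectra_subset_sphere : periodicSpectra ν ⊆ Metric.sphere (0 : ℂ) 1 :=
  Set.iUnion₂_subset fun _ _ => Set.iUnion_subset fun _ =>
    spectrum.subset_circle_of_unitary (extendedCMV_mem_unitary _)

end AlmostSureSpectrum

end RandomCMV

theorem theorem3p3_general (ν : Measure 𝔻) [IsProbabilityMeasure ν] (S : Set ℂ) :
    RandomCMV.IsAlmostSureSpectrum ν S ↔ S = closure (RandomCMV.periodicSpectra ν) := by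
  have hae := RandomCMV.ae_spectrum_randomCMV_eq ν
  constructor
  · rintro ⟨-, -, hS⟩
    obtain ⟨ω, hωS, hω⟩ := (hS.and hae).exists
    exact hωS.symm.trans hω
  · rintro rfl
    exact ⟨isClosed_closure, closure_minimal (RandomCMV.periodicSpectra_subset_sphere ν)
      Metric.isClosed_sphere, hae⟩

/-- For a compactly supported probability measure `ν` on the open unit disc, the almost sure
spectrum `Σ_μ` of the random extended CMV matrices exists, is unique, and is the closure of the
union of all periodic spectra drawn from `supp ν`. -/
theorem theorem3p3 (ν : MeasureTheory.Measure Complex.UnitDisc)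
    [MeasureTheory.IsProbabilityMeasure ν] (hν : IsCompact ν.support) :
    (∃ S : Set ℂ, RandomCMV.IsAlmostSureSpectrum ν S) ∧
      ∀ S : Set ℂ, RandomCMV.IsAlmostSureSpectrum ν S →
        S = closure (RandomCMV.periodicSpectra ν) :=
  ⟨⟨_, (theorem3p3_general ν _).2 rfl⟩, fun S => (theorem3p3_general ν S).1⟩
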